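/- Let $\Gamma$ be an infinite cardinal with $\Gamma^{\omega}=\Gamma$, and write $\|\cdot\|_2$ for the norm of the real Hilbert space $\ell_2(\Gamma)$. There exists a subgroup $\mathcal D$ of $\ell_2(\Gamma)$ that is $(\sqrt2+)$-separated (that is, $\|d-h\|_2>\sqrt2$ for all distinct $d,h\in\mathcal D$) and $1$-dense (that is, for every $x\in\ell_2(\Gamma)$ there is $d\in\mathcal D$ with $\|x-d\|_2\le 1$). Let $\mathcal D$ be any such subgroup, let $$V_d=\{x\in\ell_2(\Gamma):\ \|x-d\|_2\le\|x-h\|_2\ \text{ for all } h\in\mathcal D\}\qquad(d\in\mathcal D)$$ be its Voronoi cells, let $\mathcal T=\{V_d\}_{d\in\mathcal D}$, and let $|||\cdot|||$ be the Minkowski functional of $V_0$, $|||x|||=\inf\{r>0:\ x\in rV_0\}$. Then $|||\cdot|||$ is an equivalent norm on $\ell_2(\Gamma)$, $V_d$ is the closed $|||\cdot|||$-ball with centre $d$ and radius $1$ for every $d\in\mathcal D$, and $\mathcal T$ is a tiling of $\ell_2(\Gamma)$: its members are closures of their non-empty interiors, they cover $\ell_2(\Gamma)$, and distinct members have disjoint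 interiors. With $B=\{x: |||x|||\le1\}$ and $S=\{x: |||x|||=1\}$, moreover: 1. $B$ has no LUR points: there is no $x\in S$ such that, for all sequences $(x_n)$ in $B$, $|||x+x_n|||\to2$ implies $x_n\to x$. 2. If $x_0\in S$ is a strongly exposed point of $B$ (that is, there is a continuous linear functional $f$ with $f(x_0)=\max_B f$ such that $x_n\to x_0$ for every sequence $(x_n)$ in $B$ with $f(x_n)\to f(x_0)$), then $|||\cdot|||$ is not Fréchet differentiable at $x_0$. 3. A point $x_0\in S$ is regular for $\mathcal T$ (that is, some neighbourhood of $x_0$ meets only finitely many members of $\mathcal T$) if and only if $\|x_0\|_2<1$. 4. The set of $\Delta$-QP-points of $B$ is a norm dense subset of $S$. Here $x\in\partial B$ is a $\Delta$-QP-point of $B$ if there are a neighbourhood $V$ of $x$ and finitely many continuous linear functionals $f_1,\dots,f_n$ such that $B\cap V=\{z\in V:\ f_k(z)\le f_k(x)\text{ for } k=1,\dots,n\}$. 5. $|||\cdot|||$ is not rotund: there are distinct $x,y\in S$ with $|||x+y|||=2$. 6. $|||\cdot|||$ is not Gâteaux differentiable: there is $x\ne0$ at which $|||\cdot|||$ is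 not Gâteaux differentiable. -/

import Mathlib

open Filter Topology

noncomputable section

/-- The real Hilbert space `ℓ₂(Γ)`. -/
abbrev EllTwo (Γ : Type*) : Type _ := lp (fun _ : Γ => ℝ) 2

namespace TilingNorm

variable {E : Type*} [NormedAddCommGroup E] [NormedSpace ℝ E]

/-! ### Separated and dense sets, Voronoi cells, tilings -/

/-- `D` is `(r+)`-separated: distinct points of `D` have distance strictly larger than `r`. -/
def IsStrictlySeparated (r : ℝ) (D : Set E) : Prop :=
  ∀ d ∈ D, ∀ h ∈ D, d ≠ h → r < ‖d - h‖

/-- `D` is `r`-dense: every point has distance at most `r` to some point of `D`. -/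
def IsRDense (r : ℝ) (D : Set E) : Prop :=
  ∀ x : E, ∃ d ∈ D, ‖x - d‖ ≤ r

/-- The Voronoi cell of `d` with respect to `D`. -/
def voronoiCell (D : Set E) (d : E) : Set E :=
  {x | ∀ h ∈ D, ‖x - d‖ ≤ ‖x - h‖}

/-- The family of all Voronoi cells of points of `D`. -/
def voronoiFamily (D : Set E) : Set (Set E) :=
  voronoiCell D '' D

/-- A body is a set that is the closure of its non-empty interior. -/
def IsBody (B : Set E) : Prop :=
  (interior B).Nonempty ∧ closure (interior B) = B

/-- A tiling is a family of bodies that cover the space and have mutually disjoint interiors. -/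
def IsTiling (F : Set (Set E)) : Prop :=
  (∀ B ∈ F, IsBody B) ∧ ⋃₀ F = Set.univ ∧
    ∀ A ∈ F, ∀ B ∈ F, A ≠ B → Disjoint (interior A) (interior B)

/-- `x` is singular for the family `F` if each neighbourhood of `x` meets infinitely many members
of `F`. -/
def IsSingularPoint (F : Set (Set E)) (x : E) : Prop :=
  ∀ U ∈ 𝓝 x, {T | T ∈ F ∧ (T ∩ U).Nonempty}.Infinite

/-- `x` is regular for the family `F` if it is not singular. -/
def IsRegularPoint (F : Set (Set E)) (x : E) : Prop :=
  ¬ IsSingularPoint F x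

/-- The function whose closed unit ball is meant to be the Voronoi cell of `0`: its Minkowski
gauge `x ↦ inf {r > 0 : x ∈ r • V₀}`. -/
def tilingNorm (D : Set E) : E → ℝ :=
  gauge (voronoiCell D 0)

/-! ### Equivalent norms and their geometry

Norms on `E` are given as functions `N : E → ℝ`. For an equivalent norm the topology of `E` is
also the topology of `N`, so that limits, neighbourhoods, continuity of functionals and
(Fréchet) differentiability may be taken in the given structure of `E`. -/

/-- `N` is a norm on `E` which is equivalent to the given one. -/
def IsEquivalentNorm (N : E → ℝ) : Prop :=
  (∀ x y, N (x + y) ≤ N x + N y) ∧ (∀ (c : ℝ) (x : E), N (c • x) = |c| * N x) ∧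
    ∃ a b : ℝ, 0 < a ∧ 0 < b ∧ ∀ x, a * ‖x‖ ≤ N x ∧ N x ≤ b * ‖x‖

/-- The closed unit ball of `N`. -/
def unitBall (N : E → ℝ) : Set E := {x | N x ≤ 1}

/-- The unit sphere of `N`. -/
def unitSphere (N : E → ℝ) : Set E := {x | N x = 1}

/-- `x` is a LUR point (point of local uniform rotundity) of the unit ball of `N`. -/
def IsLURPoint (N : E → ℝ) (x : E) : Prop :=
  x ∈ unitSphere N ∧ ∀ u : ℕ → E, (∀ n, u n ∈ unitBall N) →
    Tendsto (fun n => N (x + u n)) atTop (𝓝 2) → Tendsto u atTop (𝓝 x)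

/-- `x` is a strongly exposed point of `B`: some continuous functional attains its maximum over `B`
at `x`, and each maximizing sequence in `B` converges to `x`. -/
def IsStronglyExposedPoint (B : Set E) (x : E) : Prop :=
  x ∈ B ∧ ∃ f : E →L[ℝ] ℝ, (∀ y ∈ B, f y ≤ f x) ∧
    ∀ u : ℕ → E, (∀ n, u n ∈ B) →
      Tendsto (fun n => f (u n)) atTop (𝓝 (f x)) → Tendsto u atTop (𝓝 x)

/-- `x` is a `Δ`-QP-point of `B`: it is a boundary point around which `B` is the intersection of
finitely many half-spaces whose bounding hyperplanes contain `x`. -/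
def IsDeltaQPPoint (B : Set E) (x : E) : Prop :=
  x ∈ frontier B ∧ ∃ V ∈ 𝓝 x, ∃ (n : ℕ) (f : Fin n → E →L[ℝ] ℝ),
    B ∩ V = {z | z ∈ V ∧ ∀ k, f k z ≤ f k x}

/-- `N` is rotund: midpoints of distinct points of the unit sphere are not on the sphere. -/
def IsRotund (N : E → ℝ) : Prop :=
  ∀ x ∈ unitSphere N, ∀ y ∈ unitSphere N, x ≠ y → N (x + y) < 2

/-- `N` is Gâteaux differentiable at `x`: all directional derivatives at `x` exist (as two-sided
limits) and are given by a continuous linear functional. -/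
def IsGateauxDifferentiableAt (N : E → ℝ) (x : E) : Prop :=
  ∃ f : E →L[ℝ] ℝ, ∀ h : E, HasLineDerivAt ℝ N (f h) x h

/-- A norm `N` is Gâteaux differentiable if it is so at each nonzero point. -/
def IsGateauxDifferentiableNorm (N : E → ℝ) : Prop :=
  ∀ x : E, x ≠ 0 → IsGateauxDifferentiableAt N x

end TilingNorm

end

noncomputable section

namespace TilingNorm

open Metric
open scoped RealInnerProductSpace

set_option linter.unusedSectionVars false

variable {E : Type*} [NormedAddCommGroup E] [InnerProductSpace ℝ E]

/-! A point `x` is no farther from `0` than from `h` exactly when `bisector h x ≤ 1`. So `V₀` is the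
intersection of the half-spaces `bisector h ≤ 1`, and the tiling norm is the supremum of these
functionals over nonzero `h ∈ D`. Separation puts a ball of radius `1/2` in `V₀`, density puts `V₀`
in the unit ball.

Everything rests on one count (`finite_setOf_norm_sub_le`): vectors of length at most `R < 1` at
mutual distances above `√2` have inner products bounded above by a negative constant, so only
finitely many exist. Hence near a sphere point with `‖x‖ < 1` only finitely many half-spaces matter,
and `B` is polyhedral there; in infinite dimensions the finitely many active functionals have a
common kernel, so `x` lies inside a segment of the sphere. LUR points and points of Fréchet
differentiability are shown to be polyhedral too, even when `‖x‖ = 1`; the segment then excludes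
LUR, and excludes strong exposedness together with Fréchet differentiability.

A sphere point with `‖x‖ = 1` is strongly exposed, because the Hilbert ball contains `B`. If an open
patch of the sphere consisted of such points, the two norms would agree near them, giving Fréchet
differentiability at a strongly exposed point. So the points with `‖x‖ < 1` are dense. This yields
the QP density and non-rotundity, and a starting point for the failure of Gâteaux differentiability.

The subgroup comes from transfinite recursion: a point not yet within `1` of the group is shifted by
a unit vector in a fresh coordinate and added as a generator. -/

/-- The functional that is `1` on the bisecting hyperplane of `0` and `h`. -/
def bisector (h : E) : E →L[ℝ] ℝ := (2 / ‖h‖ ^ 2) • innerSL ℝ h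

theorem bisector_apply (h x : E) : bisector h x = 2 / ‖h‖ ^ 2 * ⟪h, x⟫ := by
  simp [bisector]

theorem bisector_mul_norm_sq {h : E} (h0 : h ≠ 0) (x : E) :
    bisector h x * ‖h‖ ^ 2 = ‖h‖ ^ 2 + ‖x‖ ^ 2 - ‖x - h‖ ^ 2 := by
  have : ‖h‖ ≠ 0 := norm_ne_zero_iff.2 h0
  rw [bisector_apply, norm_sub_sq_real, real_inner_comm]
  field_simp
  ring

theorem bisector_self {h : E} (h0 : h ≠ 0) : bisector h h = 2 := by
  have : ‖h‖ ≠ 0 := norm_ne_zero_iff.2 h0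
  rw [bisector_apply, real_inner_self_eq_norm_sq]
  field_simp

theorem bisector_le_one_iff {h : E} (h0 : h ≠ 0) (x : E) :
    bisector h x ≤ 1 ↔ ‖x‖ ≤ ‖x - h‖ := by
  have hp : 0 < ‖h‖ ^ 2 := by have := norm_pos_iff.2 h0; positivity
  have := bisector_mul_norm_sq h0 x
  rw [← mul_le_mul_iff_left₀ hp, this, ← sq_le_sq₀ (norm_nonneg x) (norm_nonneg (x - h))]
  constructor <;> intro h <;> linarith

/-- Otherwise the functionals in `s` would embed `E` linearly in a finite power of `ℝ`. This is how
infinite dimension enters. -/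
theorem exists_ne_zero_forall_eq_zero (hE : ¬ FiniteDimensional ℝ E) {s : Set (E →L[ℝ] ℝ)}
    (hs : s.Finite) : ∃ e : E, e ≠ 0 ∧ ∀ f ∈ s, f e = 0 := by
  by_contra! hc
  have := hs.to_subtype
  refine hE (FiniteDimensional.of_injective
    (LinearMap.pi fun f : s => (f.1 : E →ₗ[ℝ] ℝ)) ?_)
  rw [← LinearMap.ker_eq_bot, LinearMap.ker_eq_bot']
  intro e he
  by_contra h0
  obtain ⟨f, hf, hfe⟩ := hc e h0
  exact hfe (congrFun he ⟨f, hf⟩)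

/-! ### The cell of `0` and its gauge. -/

variable {D : AddSubgroup E}

theorem IsStrictlySeparated.two_lt_norm_sq (hs : IsStrictlySeparated (Real.sqrt 2) (D : Set E))
    {h : E} (hD : h ∈ D) (h0 : h ≠ 0) : 2 < ‖h‖ ^ 2 := by
  have := hs h hD 0 D.zero_mem h0
  rw [sub_zero] at this
  exact (Real.sqrt_lt (by norm_num) (norm_nonneg h)).1 this

theorem abs_bisector_le (hs : IsStrictlySeparated (Real.sqrt 2) (D : Set E))
    {h : E} (hD : h ∈ D) (h0 : h ≠ 0) (x : E) : |bisector h x| ≤ 2 * ‖x‖ := by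
  have h2 := hs.two_lt_norm_sq hD h0
  have h1 : 1 ≤ ‖h‖ := by nlinarith [norm_nonneg h]
  have hp : 0 < ‖h‖ ^ 2 := by linarith
  rw [bisector_apply, abs_mul, abs_of_pos (by positivity : 0 < 2 / ‖h‖ ^ 2), div_mul_eq_mul_div,
    div_le_iff₀ hp]
  have := abs_real_inner_le_norm h x
  nlinarith [mul_nonneg (norm_nonneg h) (norm_nonneg x), norm_nonneg x,
    mul_le_mul_of_nonneg_right h1 (mul_nonneg (norm_nonneg h) (norm_nonneg x))]

theorem mem_voronoiCell_zero {x : E} :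
    x ∈ voronoiCell (D : Set E) 0 ↔ ∀ h ∈ D, h ≠ 0 → bisector h x ≤ 1 := by
  simp only [voronoiCell, Set.mem_ofPred_eq, sub_zero, SetLike.mem_coe]
  refine forall₂_congr fun h _ => ?_
  constructor
  · intro hx h0
    exact (bisector_le_one_iff h0 x).2 hx
  · intro hx
    by_cases h0 : h = 0
    · simp [h0]
    · exact (bisector_le_one_iff h0 x).1 (hx h0)

theorem mem_voronoiCell_iff_sub {d : E} (hd : d ∈ D) {x : E} :
    x ∈ voronoiCell (D : Set E) d ↔ x - d ∈ voronoiCell (D : Set E) 0 := by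
  simp only [voronoiCell, Set.mem_ofPred_eq, sub_zero, SetLike.mem_coe]
  constructor
  · intro hx h hh
    have := hx (d + h) (D.add_mem hd hh)
    rwa [← sub_sub] at this
  · intro hx h hh
    have := hx (h - d) (D.sub_mem hh hd)
    rwa [sub_sub_sub_cancel_right] at this

theorem isClosed_voronoiCell (D : Set E) (d : E) : IsClosed (voronoiCell D d) := by
  have : voronoiCell D d = ⋂ h ∈ D, {x | ‖x - d‖ ≤ ‖x - h‖} := by
    ext; simp [voronoiCell]
  rw [this]
  exact isClosed_biInter fun h _ => isClosed_le (by fun_prop) (by fun_prop)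

theorem convex_voronoiCell_zero : Convex ℝ (voronoiCell (D : Set E) 0) := by
  intro x hx y hy a b ha hb hab
  rw [mem_voronoiCell_zero] at *
  intro h hD h0
  rw [map_add, map_smul, map_smul, smul_eq_mul, smul_eq_mul]
  nlinarith [hx h hD h0, hy h hD h0]

theorem neg_mem_voronoiCell_zero {x : E} (hx : x ∈ voronoiCell (D : Set E) 0) :
    -x ∈ voronoiCell (D : Set E) 0 := by
  intro h hh
  have := hx (-h) (D.neg_mem hh)
  rw [sub_zero] at *
  rw [norm_neg]
  rwa [show -x - h = -(x - -h) by abel, norm_neg]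

theorem closedBall_subset_voronoiCell (hs : IsStrictlySeparated (Real.sqrt 2) (D : Set E)) :
    closedBall (0 : E) (1 / 2) ⊆ voronoiCell (D : Set E) 0 := by
  intro x hx
  rw [mem_closedBall_zero_iff] at hx
  rw [mem_voronoiCell_zero]
  intro h hD h0
  linarith [abs_bisector_le hs hD h0 x, le_abs_self (bisector h x)]

theorem norm_le_one_of_mem_voronoiCell (hd : IsRDense 1 (D : Set E)) {x : E}
    (hx : x ∈ voronoiCell (D : Set E) 0) : ‖x‖ ≤ 1 := by
  obtain ⟨d, hdD, h⟩ := hd x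
  have := hx d hdD
  rw [sub_zero] at this
  exact this.trans h

theorem voronoiCell_mem_nhds (hs : IsStrictlySeparated (Real.sqrt 2) (D : Set E)) :
    voronoiCell (D : Set E) 0 ∈ 𝓝 0 :=
  mem_of_superset (closedBall_mem_nhds 0 (by norm_num)) (closedBall_subset_voronoiCell hs)

theorem tilingNorm_le_one_iff (hs : IsStrictlySeparated (Real.sqrt 2) (D : Set E)) {x : E} :
    tilingNorm (D : Set E) x ≤ 1 ↔ x ∈ voronoiCell (D : Set E) 0 := by
  rw [tilingNorm, gauge_le_one_iff_mem_closure convex_voronoiCell_zero (voronoiCell_mem_nhds hs),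
    (isClosed_voronoiCell _ _).closure_eq]

theorem isEquivalentNorm_tilingNorm (hs : IsStrictlySeparated (Real.sqrt 2) (D : Set E))
    (hd : IsRDense 1 (D : Set E)) : IsEquivalentNorm (tilingNorm (D : Set E)) := by
  have habs := absorbent_nhds_zero (𝕜 := ℝ) (voronoiCell_mem_nhds hs)
  refine ⟨fun x y => gauge_add_le convex_voronoiCell_zero habs x y, fun c x => ?_,
    1, 2, one_pos, two_pos, fun x => ⟨?_, ?_⟩⟩
  · have := gauge_smul (𝕜 := ℝ) (s := voronoiCell (D : Set E) 0)
      ((balanced_iff_neg_mem convex_voronoiCell_zero).2 fun {x} hx => neg_mem_voronoiCell_zero hx)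
      c x
    simpa [tilingNorm] using this
  · have := le_gauge_of_subset_closedBall habs zero_le_one
      (fun y hy => mem_closedBall_zero_iff.2 (norm_le_one_of_mem_voronoiCell hd hy)) (x := x)
    simpa [tilingNorm] using this
  · have := mul_gauge_le_norm (x := x)
      ((ball_subset_closedBall).trans (closedBall_subset_voronoiCell hs))
    rw [tilingNorm]
    linarith

theorem bisector_le_tilingNorm (hs : IsStrictlySeparated (Real.sqrt 2) (D : Set E))
    (hd : IsRDense 1 (D : Set E)) {h : E} (hD : h ∈ D) (h0 : h ≠ 0) (x : E) :
    bisector h x ≤ tilingNorm (D : Set E) x := by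
  obtain ⟨-, hsm, a, b, ha, hb, hab⟩ := isEquivalentNorm_tilingNorm hs hd
  set N := tilingNorm (D : Set E)
  by_cases hx : x = 0
  · subst hx
    have := (hab 0).1
    simpa using this
  have hN : 0 < N x := lt_of_lt_of_le (mul_pos ha (norm_pos_iff.2 hx)) (hab x).1
  have h1 : N ((N x)⁻¹ • x) ≤ 1 := by
    rw [hsm, abs_of_pos (inv_pos.2 hN), inv_mul_cancel₀ hN.ne']
  have h2 := mem_voronoiCell_zero.1 ((tilingNorm_le_one_iff hs).1 h1) h hD h0
  rwa [map_smul, smul_eq_mul, inv_mul_le_iff₀ hN, mul_one] at h2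

theorem tilingNorm_le_of_forall_bisector_le (hs : IsStrictlySeparated (Real.sqrt 2) (D : Set E))
    (hd : IsRDense 1 (D : Set E)) {x : E} {c : ℝ} (hc : 0 < c)
    (hx : ∀ h ∈ D, h ≠ 0 → bisector h x ≤ c) : tilingNorm (D : Set E) x ≤ c := by
  obtain ⟨-, hsm, -⟩ := isEquivalentNorm_tilingNorm hs hd
  have h1 : c⁻¹ • x ∈ voronoiCell (D : Set E) 0 := by
    rw [mem_voronoiCell_zero]
    intro h hD h0
    rw [map_smul, smul_eq_mul, inv_mul_le_iff₀ hc, mul_one]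
    exact hx h hD h0
  rw [← tilingNorm_le_one_iff hs, hsm, abs_of_pos (inv_pos.2 hc), inv_mul_le_iff₀ hc, mul_one] at h1
  exact h1

theorem continuous_tilingNorm (hs : IsStrictlySeparated (Real.sqrt 2) (D : Set E)) :
    Continuous (tilingNorm (D : Set E)) :=
  continuous_gauge convex_voronoiCell_zero (voronoiCell_mem_nhds hs)

theorem norm_le_one_of_mem_unitSphere (hs : IsStrictlySeparated (Real.sqrt 2) (D : Set E))
    (hd : IsRDense 1 (D : Set E)) {x : E} (hx : x ∈ unitSphere (tilingNorm (D : Set E))) :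
    ‖x‖ ≤ 1 :=
  norm_le_one_of_mem_voronoiCell hd ((tilingNorm_le_one_iff hs).1 (le_of_eq hx))

theorem exists_bisector_gt (hs : IsStrictlySeparated (Real.sqrt 2) (D : Set E))
    (hd : IsRDense 1 (D : Set E)) {x : E} (hx : x ∈ unitSphere (tilingNorm (D : Set E)))
    {ε : ℝ} (hε : 0 < ε) : ∃ h ∈ D, h ≠ 0 ∧ 1 - ε < bisector h x := by
  by_contra! hc
  -- The maximum with `1 / 2` keeps the bound positive when `ε ≥ 1`.
  have := tilingNorm_le_of_forall_bisector_le hs hd (x := x) (c := max (1 - ε) (1 / 2))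
    (by positivity) fun h hD h0 => (hc h hD h0).trans (le_max_left _ _)
  rw [show tilingNorm (D : Set E) x = 1 from hx] at this
  rcases le_max_iff.1 this with h | h <;> linarith

/-! ### Local finiteness away from distance one -/

/-- For `n` such points, the squared norm of `∑ (x - d)` is nonnegative but at most `n² (R² - 1) +
n`, whence `n ≤ 1 / (1 - R²)`. -/
theorem finite_setOf_norm_sub_le (hs : IsStrictlySeparated (Real.sqrt 2) (D : Set E))
    (x : E) {R : ℝ} (hR0 : 0 ≤ R) (hR : R < 1) : {d : E | d ∈ D ∧ ‖x - d‖ ≤ R}.Finite := by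
  classical
  by_contra hinf
  have hc : 0 < 1 - R ^ 2 := by nlinarith
  obtain ⟨n, hn⟩ := exists_nat_gt (1 / (1 - R ^ 2))
  rw [div_lt_iff₀ hc] at hn
  have hn0 : 0 < (n : ℝ) := by
    by_contra! h
    nlinarith
  obtain ⟨t, ht, rfl⟩ := Set.Infinite.exists_subset_card_eq hinf n
  have key : ∀ d ∈ t, ∀ e ∈ t, ⟪x - d, x - e⟫ ≤ (R ^ 2 - 1) + if d = e then 1 else 0 := by
    intro d hdt e het
    have h1 := (ht hdt).2
    have h2 := (ht het).2
    have h1' : ‖x - d‖ ^ 2 ≤ R ^ 2 := by gcongr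
    have h2' : ‖x - e‖ ^ 2 ≤ R ^ 2 := by gcongr
    split_ifs with hde
    · subst hde
      rw [real_inner_self_eq_norm_sq]; linarith
    · have h3 := hs.two_lt_norm_sq (D.sub_mem (ht het).1 (ht hdt).1) (sub_ne_zero.2 (Ne.symm hde))
      have h4 := norm_sub_sq_real (x - d) (x - e)
      rw [sub_sub_sub_cancel_left] at h4
      linarith
  have h0 : 0 ≤ ⟪∑ d ∈ t, (x - d), ∑ e ∈ t, (x - e)⟫ := real_inner_self_nonneg
  rw [sum_inner] at h0
  simp only [inner_sum] at h0
  have h1 := h0.trans (Finset.sum_le_sum fun d hd => Finset.sum_le_sum fun e he => key d hd e he)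
  simp only [Finset.sum_add_distrib, Finset.sum_const, nsmul_eq_mul, Finset.sum_ite_eq] at h1
  simp at h1
  nlinarith

/-! ### The cells as a tiling. -/

/-- A nearest point exists: either some distance is below `1` and only finitely many points compete,
or the point supplied by density is already nearest. -/
theorem exists_mem_voronoiCell (hs : IsStrictlySeparated (Real.sqrt 2) (D : Set E))
    (hd : IsRDense 1 (D : Set E)) (x : E) : ∃ d ∈ D, x ∈ voronoiCell (D : Set E) d := by
  by_cases hx : ∀ d ∈ D, 1 ≤ ‖x - d‖
  · obtain ⟨d, hdD, h⟩ := hd x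
    exact ⟨d, hdD, fun k hk => h.trans (hx k hk)⟩
  push Not at hx
  obtain ⟨d₀, hd₀, h₀⟩ := hx
  obtain ⟨d, hdm, hmin⟩ := Set.exists_min_image _ (fun d => ‖x - d‖)
    (finite_setOf_norm_sub_le hs x (norm_nonneg _) h₀) ⟨d₀, hd₀, le_rfl⟩
  refine ⟨d, hdm.1, fun k hk => ?_⟩
  by_cases hkd : ‖x - k‖ ≤ ‖x - d₀‖
  · exact hmin k ⟨hk, hkd⟩
  · exact hdm.2.trans (not_le.1 hkd).le

theorem voronoiCell_eq (hs : IsStrictlySeparated (Real.sqrt 2) (D : Set E)) {d : E} (hd : d ∈ D) :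
    voronoiCell (D : Set E) d = {x | tilingNorm (D : Set E) (x - d) ≤ 1} := by
  ext x
  rw [Set.mem_ofPred_eq, tilingNorm_le_one_iff hs, mem_voronoiCell_iff_sub hd]

theorem convex_voronoiCell {d : E} (hd : d ∈ D) : Convex ℝ (voronoiCell (D : Set E) d) := by
  have : voronoiCell (D : Set E) d = (fun x => x + -d) ⁻¹' voronoiCell (D : Set E) 0 := by
    ext x
    rw [mem_voronoiCell_iff_sub hd, Set.mem_preimage, sub_eq_add_neg]
  rw [this]
  exact convex_voronoiCell_zero.translate_preimage_left _

theorem isTiling_voronoiFamily (hs : IsStrictlySeparated (Real.sqrt 2) (D : Set E))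
    (hd : IsRDense 1 (D : Set E)) : IsTiling (voronoiFamily (D : Set E)) := by
  refine ⟨?_, ?_, ?_⟩
  · rintro _ ⟨d, hdD, rfl⟩
    have hne : (interior (voronoiCell (D : Set E) d)).Nonempty := by
      refine ⟨d, mem_interior_iff_mem_nhds.2 (mem_of_superset
        (closedBall_mem_nhds d (by norm_num : (0 : ℝ) < 1 / 2)) fun x hx => ?_)⟩
      rw [mem_voronoiCell_iff_sub hdD]
      exact closedBall_subset_voronoiCell hs (by simpa [dist_eq_norm] using hx)
    refine ⟨hne, ?_⟩
    rw [(convex_voronoiCell hdD).closure_interior_eq_closure_of_nonempty_interior hne,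
      (isClosed_voronoiCell _ _).closure_eq]
  · rw [Set.eq_univ_iff_forall]
    intro x
    obtain ⟨d, hdD, hx⟩ := exists_mem_voronoiCell hs hd x
    exact ⟨_, ⟨d, hdD, rfl⟩, hx⟩
  · rintro _ ⟨d, hdD, rfl⟩ _ ⟨k, hkD, rfl⟩ hne
    rw [Set.disjoint_left]
    intro x hxd hxk
    have hdk : k - d ≠ 0 := by
      intro h
      rw [sub_eq_zero] at h
      exact hne (by rw [h])
    -- Moving slightly towards `k` stays in the cell of `d`, so the bisector inequality is strict at
    -- `x`; but `x` also lies in the cell of `k`.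
    have hcont : Tendsto (fun t : ℝ => x + t • (k - d)) (𝓝[>] 0) (𝓝 x) := by
      have : Continuous fun t : ℝ => x + t • (k - d) := by fun_prop
      simpa using (this.tendsto 0).mono_left nhdsWithin_le_nhds
    obtain ⟨t, ht, ht0⟩ := ((hcont.eventually (mem_interior_iff_mem_nhds.1 hxd)).and
      self_mem_nhdsWithin).exists
    have hx1 := mem_voronoiCell_zero.1 ((mem_voronoiCell_iff_sub hdD).1 ht) _
      (D.sub_mem hkD hdD) hdk
    have hx2 : ‖x - k‖ ≤ ‖x - d‖ := interior_subset hxk d hdD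
    rw [add_sub_right_comm, map_add, map_smul, bisector_self hdk, smul_eq_mul] at hx1
    have hlt : bisector (k - d) (x - d) < 1 := by
      have : (0 : ℝ) < t := ht0
      linarith
    have hge := bisector_mul_norm_sq hdk (x - d)
    rw [sub_sub_sub_cancel_right] at hge
    have hp : 0 < ‖k - d‖ ^ 2 := by have := norm_pos_iff.2 hdk; positivity
    have : ‖x - k‖ ^ 2 ≤ ‖x - d‖ ^ 2 := by gcongr
    nlinarith

open scoped RealInnerProductSpace

/-! ### Polyhedral points of the sphere -/

theorem norm_le_tilingNorm (hs : IsStrictlySeparated (Real.sqrt 2) (D : Set E))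
    (hd : IsRDense 1 (D : Set E)) (x : E) : ‖x‖ ≤ tilingNorm (D : Set E) x := by
  have := le_gauge_of_subset_closedBall (absorbent_nhds_zero (𝕜 := ℝ) (voronoiCell_mem_nhds hs))
    zero_le_one
    (fun y hy => mem_closedBall_zero_iff.2 (norm_le_one_of_mem_voronoiCell hd hy)) (x := x)
  simpa [tilingNorm] using this

theorem mem_unitSphere_of_bisector_eq_one (hs : IsStrictlySeparated (Real.sqrt 2) (D : Set E))
    (hd : IsRDense 1 (D : Set E)) {x : E} (hx : x ∈ voronoiCell (D : Set E) 0) {h : E}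
    (hD : h ∈ D) (h0 : h ≠ 0) (hhx : bisector h x = 1) :
    x ∈ unitSphere (tilingNorm (D : Set E)) :=
  le_antisymm ((tilingNorm_le_one_iff hs).2 hx) (hhx ▸ bisector_le_tilingNorm hs hd hD h0 x)

/-- The points of `D` whose bisecting hyperplanes with `0` come within `ε` of `x`. -/
def nearActive (D : AddSubgroup E) (x : E) (ε : ℝ) : Set E :=
  {h | h ∈ D ∧ h ≠ 0 ∧ 1 - ε < bisector h x}

/-- Near `x`, the cell of `0` is cut out by the bisecting hyperplanes of the points of the finite
set `F`, all of which pass through `x`. -/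
structure IsPolyhedralAt (D : AddSubgroup E) (x : E) (F : Set E) : Prop where
  finite : F.Finite
  nonempty : F.Nonempty
  mem : ∀ h ∈ F, h ∈ D
  ne_zero : ∀ h ∈ F, h ≠ 0
  eq_one : ∀ h ∈ F, bisector h x = 1
  eventually_iff : ∀ᶠ z in 𝓝 x, z ∈ voronoiCell (D : Set E) 0 ↔ ∀ h ∈ F, bisector h z ≤ 1

/-- Finiteness leaves a gap `η`: every bisector is `1` at `x` or at most `1 - η`. Within distance `η
/ 2` of `x` the latter remain below `1`, since bisectors are `2`-Lipschitz. -/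
theorem exists_isPolyhedralAt (hs : IsStrictlySeparated (Real.sqrt 2) (D : Set E))
    (hd : IsRDense 1 (D : Set E)) {x : E} (hx : x ∈ unitSphere (tilingNorm (D : Set E)))
    {ε : ℝ} (hε : 0 < ε) (hfin : (nearActive D x ε).Finite) : ∃ F, IsPolyhedralAt D x F := by
  have hxV := mem_voronoiCell_zero.1 ((tilingNorm_le_one_iff hs).1 (le_of_eq hx))
  obtain ⟨η, ⟨hη, hηε⟩, hη0⟩ : ∃ η : ℝ, ((∀ h ∈ nearActive D x ε, bisector h x < 1 →
      η < 1 - bisector h x) ∧ η < ε) ∧ η ∈ Set.Ioi (0 : ℝ) := by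
    refine Eventually.exists (f := 𝓝[>] (0 : ℝ)) (((?_ : ∀ᶠ η in 𝓝[>] (0 : ℝ), _).and ?_).and
      self_mem_nhdsWithin)
    · refine (eventually_all_finite hfin).2 fun h _ => ?_
      by_cases hlt : bisector h x < 1
      · filter_upwards [nhdsWithin_le_nhds (eventually_lt_nhds (sub_pos.2 hlt))] with η h _ using h
      · exact Eventually.of_forall fun η h => absurd h hlt
    · exact nhdsWithin_le_nhds (eventually_lt_nhds hε)
  have hη0 : 0 < η := hη0
  have gap : ∀ h ∈ D, h ≠ 0 → bisector h x = 1 ∨ bisector h x ≤ 1 - η := by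
    intro h hD h0
    by_cases hA : 1 - ε < bisector h x
    · rcases (hxV h hD h0).lt_or_eq with hlt | heq
      · right; linarith [hη h ⟨hD, h0, hA⟩ hlt]
      · exact Or.inl heq
    · right; linarith
  refine ⟨{h | h ∈ D ∧ h ≠ 0 ∧ bisector h x = 1}, ?_, ?_, fun h hh => hh.1, fun h hh => hh.2.1,
    fun h hh => hh.2.2, ?_⟩
  · refine hfin.subset fun h hh => ⟨hh.1, hh.2.1, ?_⟩
    rw [hh.2.2]; linarith
  · obtain ⟨h, hD, h0, hh⟩ := exists_bisector_gt hs hd hx hη0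
    rcases gap h hD h0 with h1 | h1
    · exact ⟨h, hD, h0, h1⟩
    · linarith
  · filter_upwards [ball_mem_nhds x (half_pos hη0)] with z hz
    rw [mem_ball, dist_eq_norm] at hz
    rw [mem_voronoiCell_zero]
    refine ⟨fun hzV h hh => hzV h hh.1 hh.2.1, fun hzF h hD h0 => ?_⟩
    rcases gap h hD h0 with h1 | h1
    · exact hzF h ⟨hD, h0, h1⟩
    · have h2 := (le_abs_self _).trans (abs_bisector_le hs hD h0 (z - x))
      rw [map_sub] at h2
      linarith

theorem IsPolyhedralAt.eventually_mem_unitSphere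
    (hs : IsStrictlySeparated (Real.sqrt 2) (D : Set E)) (hd : IsRDense 1 (D : Set E))
    {x : E} {F : Set E} (hF : IsPolyhedralAt D x F) {e : E} (he : ∀ h ∈ F, bisector h e = 0) :
    ∀ᶠ t : ℝ in 𝓝 0, x + t • e ∈ unitSphere (tilingNorm (D : Set E)) := by
  have hcont : Tendsto (fun t : ℝ => x + t • e) (𝓝 0) (𝓝 x) := by
    have : Continuous fun t : ℝ => x + t • e := by fun_prop
    simpa using this.tendsto 0
  have heq : ∀ (t : ℝ), ∀ h ∈ F, bisector h (x + t • e) = 1 := by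
    intro t h hh
    rw [map_add, map_smul, he h hh, hF.eq_one h hh, smul_zero, add_zero]
  filter_upwards [hcont.eventually hF.eventually_iff] with t ht
  obtain ⟨h, hh⟩ := hF.nonempty
  exact mem_unitSphere_of_bisector_eq_one hs hd (ht.2 fun k hk => (heq t k hk).le)
    (hF.mem h hh) (hF.ne_zero h hh) (heq t h hh)

/-- A polyhedral point lies in the relative interior of a segment of the sphere, on which any
prescribed functional is constant. -/
theorem IsPolyhedralAt.exists_ne (hE : ¬ FiniteDimensional ℝ E)
    (hs : IsStrictlySeparated (Real.sqrt 2) (D : Set E)) (hd : IsRDense 1 (D : Set E))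
    {x : E} {F : Set E} (hF : IsPolyhedralAt D x F) (f : E →L[ℝ] ℝ) :
    ∃ y ∈ unitSphere (tilingNorm (D : Set E)), y ≠ x ∧ f y = f x ∧
      tilingNorm (D : Set E) (x + y) = 2 := by
  obtain ⟨e, he0, he⟩ := exists_ne_zero_forall_eq_zero hE
    ((hF.finite.image bisector).union (Set.finite_singleton f))
  have heF : ∀ h ∈ F, bisector h e = 0 := fun h hh => he _ (Or.inl ⟨h, hh, rfl⟩)
  obtain ⟨t, ht, ht0⟩ := (((hF.eventually_mem_unitSphere hs hd heF).filter_mono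
    nhdsWithin_le_nhds).and (self_mem_nhdsWithin (s := Set.Ioi (0 : ℝ)))).exists
  have ht0 : 0 < t := ht0
  obtain ⟨h, hh⟩ := hF.nonempty
  have hh1 := hF.eq_one h hh
  obtain ⟨hadd, -⟩ := isEquivalentNorm_tilingNorm hs hd
  have hx : tilingNorm (D : Set E) x = 1 := by
    have := (hF.eventually_mem_unitSphere hs hd heF).self_of_nhds
    simpa [unitSphere] using this
  have ht' : tilingNorm (D : Set E) (x + t • e) = 1 := ht
  refine ⟨x + t • e, ht, ?_, ?_, le_antisymm ?_ ?_⟩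
  · simp [ht0.ne', he0]
  · rw [map_add, map_smul, he f (Or.inr rfl), smul_zero, add_zero]
  · linarith [hadd x (x + t • e)]
  · have := bisector_le_tilingNorm hs hd (hF.mem h hh) (hF.ne_zero h hh) (x + (x + t • e))
    rw [map_add, map_add, map_smul, heF h hh, hh1, smul_zero] at this
    linarith

theorem frontier_unitBall (hs : IsStrictlySeparated (Real.sqrt 2) (D : Set E)) :
    frontier (unitBall (tilingNorm (D : Set E))) ⊆ unitSphere (tilingNorm (D : Set E)) :=
  frontier_le_subset_eq (continuous_tilingNorm hs) continuous_const

theorem unitSphere_subset_frontier (hs : IsStrictlySeparated (Real.sqrt 2) (D : Set E))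
    (hd : IsRDense 1 (D : Set E)) :
    unitSphere (tilingNorm (D : Set E)) ⊆ frontier (unitBall (tilingNorm (D : Set E))) := by
  intro x hx
  refine ⟨subset_closure (le_of_eq hx), fun hint => ?_⟩
  obtain ⟨-, hsm, -⟩ := isEquivalentNorm_tilingNorm hs hd
  have hcont : Tendsto (fun t : ℝ => t • x) (𝓝[>] 1) (𝓝 x) := by
    have : Continuous fun t : ℝ => t • x := by fun_prop
    simpa using (this.tendsto 1).mono_left nhdsWithin_le_nhds
  obtain ⟨t, ht, ht1⟩ := ((hcont.eventually (mem_interior_iff_mem_nhds.1 hint)).and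
    self_mem_nhdsWithin).exists
  have ht1 : 1 < t := ht1
  have ht : tilingNorm (D : Set E) (t • x) ≤ 1 := ht
  rw [hsm, show tilingNorm (D : Set E) x = 1 from hx, abs_of_pos (by linarith)] at ht
  linarith

theorem IsPolyhedralAt.isDeltaQPPoint (hs : IsStrictlySeparated (Real.sqrt 2) (D : Set E))
    (hd : IsRDense 1 (D : Set E)) {x : E} {F : Set E} (hF : IsPolyhedralAt D x F) :
    IsDeltaQPPoint (unitBall (tilingNorm (D : Set E))) x := by
  have hx : x ∈ unitSphere (tilingNorm (D : Set E)) := by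
    simpa using (hF.eventually_mem_unitSphere hs hd (e := 0) (by simp)).self_of_nhds
  have := hF.finite.to_subtype
  obtain ⟨n, ⟨e⟩⟩ := Finite.exists_equiv_fin F
  refine ⟨unitSphere_subset_frontier hs hd hx, _, hF.eventually_iff, n,
    fun k => bisector (e.symm k).1, ?_⟩
  ext z
  simp only [Set.mem_inter_iff, Set.mem_ofPred_eq, unitBall, tilingNorm_le_one_iff hs]
  rw [and_comm]
  refine and_congr_right fun hz => hz.trans ?_
  rw [e.symm.forall_congr_left]
  simp only [Equiv.symm_symm, Subtype.forall, Equiv.symm_apply_apply]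
  exact forall₂_congr fun h hh => by rw [hF.eq_one h hh]

theorem norm_lt_four_of_bisector {x h : E} (hx : ‖x‖ ≤ 1) (h0 : h ≠ 0)
    (hb : 1 / 2 < bisector h x) : ‖h‖ < 4 := by
  have hp : 0 < ‖h‖ := norm_pos_iff.2 h0
  rw [bisector_apply, div_mul_eq_mul_div, lt_div_iff₀ (by positivity)] at hb
  have := real_inner_le_norm h x
  nlinarith

/-- Almost active points of `D` are almost as near to `x` as `0` is, which allows the finiteness
count. -/
theorem norm_sub_sq_lt_of_mem_nearActive {x h : E} {ε : ℝ} (hx : ‖x‖ ≤ 1) (hε0 : 0 < ε)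
    (hε : ε ≤ 1 / 2) (hh : h ∈ nearActive D x ε) : ‖x - h‖ ^ 2 < ‖x‖ ^ 2 + 16 * ε := by
  obtain ⟨-, h0, hb⟩ := hh
  have h4 := norm_lt_four_of_bisector hx h0 (by linarith)
  have hp : 0 < ‖h‖ ^ 2 := by have := norm_pos_iff.2 h0; positivity
  have h16 : ‖h‖ ^ 2 ≤ 16 := by nlinarith [norm_nonneg h]
  have := bisector_mul_norm_sq h0 x
  nlinarith

theorem exists_isPolyhedralAt_of_norm_lt_one
    (hs : IsStrictlySeparated (Real.sqrt 2) (D : Set E)) (hd : IsRDense 1 (D : Set E)) {x : E}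
    (hx : x ∈ unitSphere (tilingNorm (D : Set E))) (hx1 : ‖x‖ < 1) :
    ∃ F, IsPolyhedralAt D x F := by
  have hx2 : ‖x‖ ^ 2 < 1 := by nlinarith [norm_nonneg x]
  have hε0 : 0 < (1 - ‖x‖ ^ 2) / 32 := by linarith
  refine exists_isPolyhedralAt hs hd hx hε0 ((finite_setOf_norm_sub_le hs x
    (Real.sqrt_nonneg ((1 + ‖x‖ ^ 2) / 2)) ?_).subset fun h hh => ⟨hh.1, ?_⟩)
  · rw [Real.sqrt_lt' one_pos]; linarith
  · refine Real.le_sqrt_of_sq_le ?_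
    have := norm_sub_sq_lt_of_mem_nearActive hx1.le hε0 (by nlinarith [norm_nonneg x]) hh
    linarith

/-! ### LUR points and strongly exposed points -/

/-- Reflecting `x` in the midpoint `h / 2` of an almost active `h` gives `h - x`, almost in `V₀`,
with `bisector h` nearly `1` at both points. At a LUR point this forces `h - x` towards `x`, so `h`
towards `2x`, and separation makes such `h` eventually constant. -/
theorem exists_isPolyhedralAt_of_isLURPoint
    (hs : IsStrictlySeparated (Real.sqrt 2) (D : Set E)) (hd : IsRDense 1 (D : Set E)) {x : E}
    (hx : IsLURPoint (tilingNorm (D : Set E)) x) : ∃ F, IsPolyhedralAt D x F := by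
  obtain ⟨hxS, hlur⟩ := hx
  have hxV : x ∈ voronoiCell (D : Set E) 0 := (tilingNorm_le_one_iff hs).1 (le_of_eq hxS)
  have hx1 := norm_le_one_of_mem_voronoiCell hd hxV
  by_contra hcon
  -- Without polyhedrality no almost active set is finite, so the only possible limit `2x` can be
  -- avoided.
  have hinf : ∀ n : ℕ, ∃ h ∈ nearActive D x (1 / (n + 2)), h ≠ (2 : ℝ) • x := by
    intro n
    by_contra! hc
    exact hcon (exists_isPolyhedralAt hs hd hxS (by positivity)
      ((Set.finite_singleton ((2 : ℝ) • x)).subset hc))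
  choose h hh hne using hinf
  have hε : Tendsto (fun n : ℕ => (1 : ℝ) / (n + 2)) atTop (𝓝 0) := by
    exact tendsto_const_nhds.div_atTop
      (tendsto_atTop_add_const_right _ (2 : ℝ) tendsto_natCast_atTop_atTop)
  set c : ℕ → ℝ := fun n => (‖x - h n‖ ^ 2 - ‖x‖ ^ 2) / 2 with hc
  have hc0 : ∀ n, 0 ≤ c n := by
    intro n
    have := hxV (h n) (hh n).1
    rw [sub_zero] at this
    have : ‖x‖ ^ 2 ≤ ‖x - h n‖ ^ 2 := by gcongr
    simp only [hc]; linarith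
  have hclim : Tendsto c atTop (𝓝 0) := by
    refine squeeze_zero hc0 (fun n => ?_) (g := fun n : ℕ => 8 * ((1 : ℝ) / (n + 2)))
      (by simpa only [mul_zero] using hε.const_mul 8)
    have h2 : (1 : ℝ) / (n + 2) ≤ 1 / 2 := by gcongr; simp
    have := norm_sub_sq_lt_of_mem_nearActive hx1 (by positivity) h2 (hh n)
    simp only [hc]; linarith
  have hone : Tendsto (fun n => 1 + c n) atTop (𝓝 1) := by simpa using hclim.const_add 1
  -- `1 + c n` suffices for scaling into `V₀`: `bisector k (h n - x) * ‖k‖ ^ 2 ≤ ‖k‖ ^ 2 + 2 * c n`,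
  -- and `‖k‖ ^ 2 > 2`.
  set u : ℕ → E := fun n => (1 + c n)⁻¹ • (h n - x) with hu
  have huV : ∀ n, u n ∈ voronoiCell (D : Set E) 0 := by
    intro n
    rw [mem_voronoiCell_zero]
    intro k hk k0
    have hp := hs.two_lt_norm_sq hk k0
    rw [hu, map_smul, smul_eq_mul, inv_mul_le_iff₀ (by linarith [hc0 n]), mul_one]
    have h1 := bisector_mul_norm_sq k0 (h n - x)
    have h2 : ‖x‖ ≤ ‖h n - x - k‖ := by
      have := hxV (h n - k) (D.sub_mem (hh n).1 hk)
      rwa [sub_zero, ← norm_neg (x - _), show -(x - (h n - k)) = h n - x - k by abel] at this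
    have h2 : ‖x‖ ^ 2 ≤ ‖h n - x - k‖ ^ 2 := by gcongr
    rw [norm_sub_rev (h n) x] at h1
    have h3 : ‖x - h n‖ ^ 2 - ‖x‖ ^ 2 = 2 * c n := by simp only [hc]; ring
    nlinarith [hc0 n]
  have hulim : Tendsto u atTop (𝓝 x) := by
    refine hlur u (fun n => (tilingNorm_le_one_iff hs).2 (huV n)) ?_
    have hlow : Tendsto (fun n : ℕ => 1 - (1 : ℝ) / (n + 2) + (1 + c n)⁻¹) atTop (𝓝 2) := by
      have := (hε.const_sub 1).add (hone.inv₀ one_ne_zero)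
      norm_num at this ⊢
      exact this
    refine tendsto_of_tendsto_of_tendsto_of_le_of_le hlow tendsto_const_nhds (fun n => ?_)
      fun n => ?_
    · obtain ⟨hD, h0, hb⟩ := hh n
      refine le_trans ?_ (bisector_le_tilingNorm hs hd hD h0 _)
      have hb1 := mem_voronoiCell_zero.1 hxV _ hD h0
      rw [map_add, hu, map_smul, map_sub, bisector_self h0, smul_eq_mul]
      refine add_le_add hb.le ?_
      have : 0 ≤ (1 + c n)⁻¹ := inv_nonneg.2 (by linarith [hc0 n])
      nlinarith
    · have h1 := (isEquivalentNorm_tilingNorm hs hd).1 x (u n)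
      have h2 := (tilingNorm_le_one_iff hs).2 (huV n)
      have h3 : tilingNorm (D : Set E) x = 1 := hxS
      simp only; linarith
  have hhlim : Tendsto h atTop (𝓝 ((2 : ℝ) • x)) := by
    have := (hone.smul hulim).add_const x
    rw [one_smul, ← two_smul ℝ] at this
    refine this.congr fun n => ?_
    rw [hu, smul_inv_smul₀ (by linarith [hc0 n]), sub_add_cancel]
  obtain ⟨n₀, hn₀⟩ := Metric.cauchySeq_iff'.1 hhlim.cauchySeq 1 one_pos
  have hconst : ∀ n ≥ n₀, h n = h n₀ := by
    intro n hn
    by_contra hne'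
    have h1 := hs.two_lt_norm_sq (D.sub_mem (hh n).1 (hh n₀).1) (sub_ne_zero.2 hne')
    have h2 := hn₀ n hn
    rw [dist_eq_norm] at h2
    nlinarith [norm_nonneg (h n - h n₀)]
  have : Tendsto h atTop (𝓝 (h n₀)) :=
    tendsto_const_nhds.congr' (eventually_atTop.2 ⟨n₀, fun n hn => (hconst n hn).symm⟩)
  exact hne n₀ (tendsto_nhds_unique this hhlim)

theorem not_isLURPoint (hE : ¬ FiniteDimensional ℝ E)
    (hs : IsStrictlySeparated (Real.sqrt 2) (D : Set E)) (hd : IsRDense 1 (D : Set E)) (x : E) :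
    ¬ IsLURPoint (tilingNorm (D : Set E)) x := by
  intro hx
  obtain ⟨F, hF⟩ := exists_isPolyhedralAt_of_isLURPoint hs hd hx
  obtain ⟨y, hy, hyx, -, hxy⟩ := hF.exists_ne hE hs hd 0
  have := hx.2 (fun _ => y) (fun _ => le_of_eq hy) (by simp only [hxy]; exact tendsto_const_nhds)
  exact hyx (tendsto_nhds_unique tendsto_const_nhds this)

/-- Almost active bisectors are all close to the derivative, hence to each other, while separation
keeps bisectors of distinct points apart. So only one is almost active. -/
theorem exists_isPolyhedralAt_of_differentiableAt
    (hs : IsStrictlySeparated (Real.sqrt 2) (D : Set E)) (hd : IsRDense 1 (D : Set E)) {x : E}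
    (hx : x ∈ unitSphere (tilingNorm (D : Set E)))
    (hdiff : DifferentiableAt ℝ (tilingNorm (D : Set E)) x) : ∃ F, IsPolyhedralAt D x F := by
  have hx1 := norm_le_one_of_mem_unitSphere hs hd hx
  obtain ⟨g, hg⟩ := hdiff
  have hg := (hasFDerivAt_iff_isLittleO_nhds_zero.1 hg).def (c := 1 / 128) (by norm_num)
  obtain ⟨δ, hδ, hg⟩ := Metric.eventually_nhds_iff_ball.1 hg
  have hN : tilingNorm (D : Set E) x = 1 := hx
  have hs0 : 0 < δ / 8 := by positivity
  set s := δ / 8 with hsδ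
  set η := min (s / 64) (1 / 2) with hη
  have hη0 : 0 < η := by positivity
  have hη2 : η ≤ 1 / 2 := min_le_right _ _
  have hηs : η ≤ s / 64 := min_le_left _ _
  have close : ∀ h ∈ nearActive D x η, ∀ v : E, ‖v‖ < δ →
      |bisector h v - g v| ≤ 1 / 128 * ‖v‖ + η := by
    intro h hh v hv
    have key : ∀ w : E, ‖w‖ < δ → bisector h w - g w ≤ 1 / 128 * ‖w‖ + η := by
      intro w hw
      have h1 := (le_abs_self _).trans (hg w (by simpa using hw))
      have h2 := bisector_le_tilingNorm hs hd hh.1 hh.2.1 (x + w)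
      rw [map_add] at h2
      rw [hN] at h1
      linarith [hh.2.2]
    have h1 := key v hv
    have h2 := key (-v) (by rwa [norm_neg])
    rw [map_neg, map_neg, norm_neg] at h2
    rw [abs_le]
    constructor <;> linarith
  have aux : ∀ h ∈ nearActive D x η, ∀ k ∈ nearActive D x η, ‖k‖ ≤ ‖h‖ → h = k := by
    intro h hh k hk hkh
    by_contra hne
    have hh4 := norm_lt_four_of_bisector hx1 hh.2.1 (by linarith [hh.2.2])
    have hp : 0 < ‖h‖ := norm_pos_iff.2 hh.2.1
    have hsep := hs.two_lt_norm_sq (D.sub_mem hk.1 hh.1) (sub_ne_zero.2 (Ne.symm hne))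
    have hbk := bisector_mul_norm_sq hh.2.1 k
    -- Separation gives `bisector h k * ‖h‖ ^ 2 < 2 * ‖h‖ ^ 2 - 2` with `‖h‖ < 4`. At `s • k` the
    -- two bisectors then differ by at least `s / 8`, against at most `2 * (s / 32 + s / 64)` by
    -- closeness to `g`.
    have hlt : bisector h k ≤ 2 - 1 / 8 := by
      by_contra! hcon
      have h1 : (2 - 1 / 8) * ‖h‖ ^ 2 < bisector h k * ‖h‖ ^ 2 := by gcongr
      nlinarith [norm_nonneg k]
    have hnk : ‖s • k‖ ≤ s * 4 := by
      rw [norm_smul, Real.norm_of_nonneg hs0.le]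
      gcongr
      linarith
    have h1 := close h hh (s • k) (by linarith)
    have h2 := close k hk (s • k) (by linarith)
    rw [map_smul, smul_eq_mul, abs_le] at h1 h2
    rw [bisector_self hk.2.1] at h2
    nlinarith
  refine exists_isPolyhedralAt hs hd hx hη0 (Set.Subsingleton.finite fun h hh k hk => ?_)
  rcases le_total ‖k‖ ‖h‖ with hle | hle
  · exact aux h hh k hk hle
  · exact (aux k hk h hh hle).symm

theorem IsStronglyExposedPoint.not_differentiableAt (hE : ¬ FiniteDimensional ℝ E)
    (hs : IsStrictlySeparated (Real.sqrt 2) (D : Set E)) (hd : IsRDense 1 (D : Set E)) {x : E}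
    (hx : x ∈ unitSphere (tilingNorm (D : Set E)))
    (hexp : IsStronglyExposedPoint (unitBall (tilingNorm (D : Set E))) x) :
    ¬ DifferentiableAt ℝ (tilingNorm (D : Set E)) x := by
  intro hdiff
  obtain ⟨F, hF⟩ := exists_isPolyhedralAt_of_differentiableAt hs hd hx hdiff
  obtain ⟨-, f, -, hf⟩ := hexp
  obtain ⟨y, hy, hyx, hfy, -⟩ := hF.exists_ne hE hs hd f
  have := hf (fun _ => y) (fun _ => le_of_eq hy) (by simp only [hfy]; exact tendsto_const_nhds)
  exact hyx (tendsto_nhds_unique tendsto_const_nhds this)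

theorem isStronglyExposedPoint_of_norm_eq_one
    (hs : IsStrictlySeparated (Real.sqrt 2) (D : Set E)) (hd : IsRDense 1 (D : Set E)) {x : E}
    (hx : x ∈ unitSphere (tilingNorm (D : Set E))) (hx1 : ‖x‖ = 1) :
    IsStronglyExposedPoint (unitBall (tilingNorm (D : Set E))) x := by
  have hball : ∀ y ∈ unitBall (tilingNorm (D : Set E)), ‖y‖ ≤ 1 :=
    fun y hy => (norm_le_tilingNorm hs hd y).trans hy
  have hxx : innerSL ℝ x x = 1 := by
    rw [innerSL_apply_apply, real_inner_self_eq_norm_sq, hx1, one_pow]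
  refine ⟨le_of_eq hx, innerSL ℝ x, fun y hy => ?_, fun u hu hlim => ?_⟩
  · rw [hxx]
    refine (real_inner_le_norm x y).trans ?_
    rw [hx1, one_mul]
    exact hball y hy
  · rw [hxx] at hlim
    rw [tendsto_iff_norm_sub_tendsto_zero]
    have hsq : Tendsto (fun n => ‖u n - x‖ ^ 2) atTop (𝓝 0) := by
      refine squeeze_zero (fun n => by positivity) (fun n => ?_)
        (g := fun n => 2 - 2 * innerSL ℝ x (u n)) ?_
      · rw [norm_sub_sq_real, hx1, innerSL_apply_apply, real_inner_comm]
        nlinarith [hball _ (hu n), norm_nonneg (u n)]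
      · simpa using (hlim.const_mul 2).const_sub 2
    simpa using hsq.sqrt

/-! ### Regular points -/

theorem isRegularPoint_of_norm_lt_one (hs : IsStrictlySeparated (Real.sqrt 2) (D : Set E))
    {x : E} (hx : ‖x‖ < 1) : IsRegularPoint (voronoiFamily (D : Set E)) x := by
  intro hsing
  set r := (1 - ‖x‖) / 3 with hr
  have hr0 : 0 < r := by simp only [hr]; linarith
  refine hsing _ (ball_mem_nhds x hr0) (((finite_setOf_norm_sub_le hs x (R := 1 - r)
    ?_ (by linarith)).image (voronoiCell (D : Set E))).subset ?_)
  · have := norm_nonneg x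
    simp only [hr]; linarith
  · rintro _ ⟨⟨d, hd, rfl⟩, y, hyd, hy⟩
    refine ⟨d, ⟨hd, ?_⟩, rfl⟩
    rw [mem_ball, dist_eq_norm] at hy
    have h1 := hyd 0 D.zero_mem
    rw [sub_zero] at h1
    have h2 := norm_sub_le_norm_sub_add_norm_sub x y d
    have h3 := norm_le_norm_add_norm_sub' y x
    rw [norm_sub_rev x y] at h2
    linarith

/-- All centres are at distance at least `1` from `x`. A small move orthogonal to `x - c` for
finitely many centres `c` makes those distances exceed `1`, so density requires another cell. -/
theorem isSingularPoint_of_one_le_norm (hE : ¬ FiniteDimensional ℝ E)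
    (hs : IsStrictlySeparated (Real.sqrt 2) (D : Set E)) (hd : IsRDense 1 (D : Set E)) {x : E}
    (hxV : x ∈ voronoiCell (D : Set E) 0) (hx : 1 ≤ ‖x‖) :
    IsSingularPoint (voronoiFamily (D : Set E)) x := by
  intro U hU
  by_contra hfin
  rw [Set.not_infinite] at hfin
  choose! c hcD hc using fun (T : Set E) (hT : T ∈ voronoiFamily (D : Set E)) => hT
  obtain ⟨e, he0, he⟩ := exists_ne_zero_forall_eq_zero hE
    (hfin.image fun T => innerSL ℝ (x - c T))
  have hcont : Tendsto (fun t : ℝ => x + t • e) (𝓝[>] 0) (𝓝 x) := by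
    have : Continuous fun t : ℝ => x + t • e := by fun_prop
    simpa using (this.tendsto 0).mono_left nhdsWithin_le_nhds
  obtain ⟨t, ht, ht0⟩ := ((hcont.eventually hU).and self_mem_nhdsWithin).exists
  have ht0 : 0 < t := ht0
  obtain ⟨d, hdD, hyd⟩ := exists_mem_voronoiCell hs hd (x + t • e)
  have hmem : voronoiCell (D : Set E) d ∈ voronoiFamily (D : Set E) := ⟨d, hdD, rfl⟩
  have hort := he _ ⟨_, ⟨hmem, _, hyd, ht⟩, rfl⟩
  have hcT := hcD _ hmem
  rw [← hc _ hmem] at hyd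
  set k := c (voronoiCell (D : Set E) d)
  obtain ⟨d', hd', h1⟩ := hd (x + t • e)
  have h1 := (hyd d' hd').trans h1
  have h2 := hxV k hcT
  rw [sub_zero] at h2
  rw [innerSL_apply_apply] at hort
  have h3 : ‖x + t • e - k‖ ^ 2 = ‖x - k‖ ^ 2 + (t * ‖e‖) ^ 2 := by
    rw [add_sub_right_comm, norm_add_sq_real, inner_smul_right, hort, norm_smul,
      Real.norm_of_nonneg ht0.le]
    ring
  have h4 : 0 < t * ‖e‖ := mul_pos ht0 (norm_pos_iff.2 he0)
  nlinarith [norm_nonneg (x + t • e - k)]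

/-! ### Density of the polyhedral points -/

theorem unitSphere_subset_closure (hE : ¬ FiniteDimensional ℝ E)
    (hs : IsStrictlySeparated (Real.sqrt 2) (D : Set E)) (hd : IsRDense 1 (D : Set E)) :
    unitSphere (tilingNorm (D : Set E)) ⊆
      closure {y | y ∈ unitSphere (tilingNorm (D : Set E)) ∧ ‖y‖ < 1} := by
  intro x hx
  by_contra hcl
  have hN : tilingNorm (D : Set E) x = 1 := hx
  have hx1 : ‖x‖ = 1 := by
    refine (norm_le_one_of_mem_unitSphere hs hd hx).eq_of_not_lt fun h => ?_
    exact hcl (subset_closure ⟨hx, h⟩)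
  refine (isStronglyExposedPoint_of_norm_eq_one hs hd hx hx1).not_differentiableAt hE hs hd hx ?_
  have hcont := continuous_tilingNorm hs
  have hnc : ContinuousAt (fun y => (tilingNorm (D : Set E) y)⁻¹ • y) x :=
    (hcont.continuousAt.inv₀ (by rw [hN]; exact one_ne_zero)).smul continuousAt_id
  have hev : tilingNorm (D : Set E) =ᶠ[𝓝 x] fun y => ‖y‖ := by
    have h1 := hnc.eventually (p := fun z =>
      z ∉ closure {y | y ∈ unitSphere (tilingNorm (D : Set E)) ∧ ‖y‖ < 1})
      (by
        simp only [hN, inv_one, one_smul]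
        exact isClosed_closure.isOpen_compl.mem_nhds hcl)
    have h2 := hcont.continuousAt.eventually (lt_mem_nhds (a := 0) (by rw [hN]; exact one_pos))
    filter_upwards [h1, h2] with y hy hpos
    have hmem : (tilingNorm (D : Set E) y)⁻¹ • y ∈ unitSphere (tilingNorm (D : Set E)) := by
      have := (isEquivalentNorm_tilingNorm hs hd).2.1 (tilingNorm (D : Set E) y)⁻¹ y
      rw [abs_of_pos (inv_pos.2 hpos), inv_mul_cancel₀ hpos.ne'] at this
      exact this
    have hge : 1 ≤ ‖(tilingNorm (D : Set E) y)⁻¹ • y‖ :=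
      not_lt.1 fun h => hy (subset_closure ⟨hmem, h⟩)
    rw [norm_smul, Real.norm_of_nonneg (inv_pos.2 hpos).le, le_inv_mul_iff₀ hpos, mul_one] at hge
    exact le_antisymm hge (norm_le_tilingNorm hs hd y)
  have hx0 : x ≠ 0 := norm_ne_zero_iff.1 (by rw [hx1]; exact one_ne_zero)
  exact hev.differentiableAt_iff.2 ((contDiffAt_norm ℝ hx0 (n := 1)).differentiableAt one_ne_zero)

theorem exists_mem_unitSphere_norm_lt_one (hE : ¬ FiniteDimensional ℝ E)
    (hs : IsStrictlySeparated (Real.sqrt 2) (D : Set E)) (hd : IsRDense 1 (D : Set E)) :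
    ∃ x ∈ unitSphere (tilingNorm (D : Set E)), ‖x‖ < 1 := by
  obtain ⟨e, he, -⟩ := exists_ne_zero_forall_eq_zero hE Set.finite_empty
  have hpos : 0 < tilingNorm (D : Set E) e :=
    (norm_pos_iff.2 he).trans_le (norm_le_tilingNorm hs hd e)
  have hmem : (tilingNorm (D : Set E) e)⁻¹ • e ∈ unitSphere (tilingNorm (D : Set E)) := by
    have := (isEquivalentNorm_tilingNorm hs hd).2.1 (tilingNorm (D : Set E) e)⁻¹ e
    rw [abs_of_pos (inv_pos.2 hpos), inv_mul_cancel₀ hpos.ne'] at this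
    exact this
  exact closure_nonempty_iff.1 ⟨_, unitSphere_subset_closure hE hs hd hmem⟩

theorem not_isRotund (hE : ¬ FiniteDimensional ℝ E)
    (hs : IsStrictlySeparated (Real.sqrt 2) (D : Set E)) (hd : IsRDense 1 (D : Set E)) :
    ¬ IsRotund (tilingNorm (D : Set E)) := by
  intro hrot
  obtain ⟨x, hx, hx1⟩ := exists_mem_unitSphere_norm_lt_one hE hs hd
  obtain ⟨F, hF⟩ := exists_isPolyhedralAt_of_norm_lt_one hs hd hx hx1
  obtain ⟨y, hy, hyx, -, hxy⟩ := hF.exists_ne hE hs hd 0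
  exact (hrot x hx y hy hyx.symm).ne hxy

/-! ### Gâteaux differentiability -/

/-- A functional below `N` that touches it at `x` must have the directional derivatives of `N`
there. -/
theorem IsGateauxDifferentiableAt.eq_of_le {N : E → ℝ} {x : E}
    (hN : IsGateauxDifferentiableAt N x) {f g : E →L[ℝ] ℝ} (hf : ∀ y, f y ≤ N y)
    (hfx : f x = N x) (hg : ∀ y, g y ≤ N y) (hgx : g x = N x) : f = g := by
  obtain ⟨l, hl⟩ := hN
  have key : ∀ k : E →L[ℝ] ℝ, (∀ y, k y ≤ N y) → k x = N x → ∀ v, k v = l v := by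
    intro k hk hkx v
    have h1 : HasDerivAt (fun t : ℝ => N (x + t • v)) (l v) 0 := hl v
    have h2 : HasDerivAt (fun t : ℝ => k (x + t • v)) (k v) 0 := by
      simp only [map_add, map_smul, smul_eq_mul]
      simpa using ((hasDerivAt_id (0 : ℝ)).mul_const (k v)).const_add (k x)
    have h3 : IsLocalMin (fun t : ℝ => N (x + t • v) - k (x + t • v)) 0 :=
      Eventually.of_forall fun t => by
        simp only [zero_smul, add_zero, hkx, sub_self]
        linarith [hk (x + t • v)]
    linarith [h3.hasDerivAt_eq_zero (h1.sub h2)]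
  ext v
  rw [key f hf hfx v, key g hg hgx v]

theorem not_isGateauxDifferentiableNorm (hE : ¬ FiniteDimensional ℝ E)
    (hs : IsStrictlySeparated (Real.sqrt 2) (D : Set E)) (hd : IsRDense 1 (D : Set E)) :
    ¬ IsGateauxDifferentiableNorm (tilingNorm (D : Set E)) := by
  intro hG
  obtain ⟨x, hx, hx1⟩ := exists_mem_unitSphere_norm_lt_one hE hs hd
  obtain ⟨F, hF⟩ := exists_isPolyhedralAt_of_norm_lt_one hs hd hx hx1
  obtain ⟨h, hh⟩ := hF.nonempty
  have hD := hF.mem h hh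
  have h0 := hF.ne_zero h hh
  obtain ⟨e, he0, he⟩ := exists_ne_zero_forall_eq_zero hE
    (Set.toFinite {bisector h, innerSL ℝ x})
  have heh : bisector h e = 0 := he _ (by simp)
  have hex : ⟪x, e⟫ = 0 := he (innerSL ℝ x) (by simp)
  have hepos : 0 < ‖e‖ := norm_pos_iff.2 he0
  have hline : ∀ t : ℝ, bisector h (x + t • e) = 1 := fun t => by
    rw [map_add, map_smul, heh, hF.eq_one h hh, smul_zero, add_zero]
  have hcont : Continuous fun t : ℝ => x + t • e := by fun_prop
  have hbound : ∀ t : ℝ, x + t • e ∈ voronoiCell (D : Set E) 0 → t ≤ 2 / ‖e‖ := by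
    intro t ht
    rw [le_div_iff₀ hepos]
    have h1 := norm_le_one_of_mem_voronoiCell hd ht
    have h2 := norm_sub_le (x + t • e) x
    rw [add_sub_cancel_left, norm_smul, Real.norm_eq_abs] at h2
    nlinarith [le_abs_self t]
  have hK : IsCompact (Set.Icc (0 : ℝ) (2 / ‖e‖) ∩
      (fun t : ℝ => x + t • e) ⁻¹' voronoiCell (D : Set E) 0) :=
    isCompact_Icc.inter_right ((isClosed_voronoiCell _ _).preimage hcont)
  have hxV : x ∈ voronoiCell (D : Set E) 0 := (tilingNorm_le_one_iff hs).1 (le_of_eq hx)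
  -- This is the last point of `V₀` on a ray inside the hyperplane `bisector h = 1`. If its norm is
  -- below `1`, uniqueness of the supporting functional lets the ray continue. If its norm is `1`,
  -- the functional is the inner product with that point, and evaluating at `e ⟂ x` gives `t = 0`.
  obtain ⟨t, ⟨ht, htV⟩, htmax⟩ := hK.exists_isMaxOn
    ⟨0, ⟨le_rfl, by positivity⟩, by simpa using hxV⟩ continuousOn_id
  have hyS := mem_unitSphere_of_bisector_eq_one hs hd htV hD h0 (hline t)
  have hyN : tilingNorm (D : Set E) (x + t • e) = 1 := hyS
  have hy0 : x + t • e ≠ 0 := by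
    intro hy
    have := hline t
    rw [hy, map_zero] at this
    exact zero_ne_one this
  have huniq := fun (f : E →L[ℝ] ℝ) (hf : ∀ y, f y ≤ tilingNorm (D : Set E) y)
    (hfy : f (x + t • e) = 1) => (hG _ hy0).eq_of_le (f := bisector h) (g := f)
    (bisector_le_tilingNorm hs hd hD h0) ((hline t).trans hyN.symm) hf (hfy.trans hyN.symm)
  rcases (norm_le_one_of_mem_unitSphere hs hd hyS).lt_or_eq with hlt | heq
  · obtain ⟨F', hF'⟩ := exists_isPolyhedralAt_of_norm_lt_one hs hd hyS hlt
    have heF : ∀ k ∈ F', bisector k e = 0 := fun k hk => by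
      rw [← huniq (bisector k) (bisector_le_tilingNorm hs hd (hF'.mem k hk) (hF'.ne_zero k hk))
        (hF'.eq_one k hk), heh]
    obtain ⟨r, hr, hr0⟩ := (((hF'.eventually_mem_unitSphere hs hd heF).filter_mono
      nhdsWithin_le_nhds).and (self_mem_nhdsWithin (s := Set.Ioi (0 : ℝ)))).exists
    have hr0 : 0 < r := hr0
    have hrV : x + (t + r) • e ∈ voronoiCell (D : Set E) 0 := by
      rw [add_smul, ← add_assoc]
      exact (tilingNorm_le_one_iff hs).1 (le_of_eq hr)
    have : t + r ≤ t := htmax ⟨⟨by linarith [ht.1], hbound _ hrV⟩, hrV⟩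
    linarith
  · have h1 := huniq (innerSL ℝ (x + t • e)) (fun y => by
      rw [innerSL_apply_apply]
      refine (real_inner_le_norm _ y).trans ?_
      rw [heq, one_mul]
      exact norm_le_tilingNorm hs hd y) (by
      rw [innerSL_apply_apply, real_inner_self_eq_norm_sq, heq, one_pow])
    have h2 := congrArg (fun f => f e) h1
    simp only [innerSL_apply_apply] at h2
    rw [heh, inner_add_left, inner_smul_left, hex, real_inner_self_eq_norm_sq] at h2
    have ht0 : t = 0 := by
      have : t * ‖e‖ ^ 2 = 0 := by simpa using h2.symm
      rcases mul_eq_zero.1 this with h | h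
      · exact h
      · exact absurd h (by positivity)
    simp only [ht0, zero_smul, add_zero] at heq
    exact hx1.ne heq

/-! ### Existence of a separated and dense subgroup -/

/-- A choice of pairwise distinct coordinates, each avoiding the supports of the earlier vectors. -/
theorem exists_fresh {I Γ : Type*} [LinearOrder I] [WellFoundedLT I] (s : I → Set Γ)
    (hs : ∀ a, ∀ u : Set Γ, (u ⊆ s a ∪ ⋃ b : Set.Iio a, s b) →
      ∀ g : Set.Iio a → Γ, ∃ x, x ∉ u ∪ Set.range g) :
    ∃ γ : I → Γ, ∀ a, γ a ∉ s a ∧ ∀ b < a, γ a ∉ s b ∧ γ a ≠ γ b := by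
  have step : ∀ a (g : ∀ b, b < a → Γ), ∃ x, x ∉ s a ∧ ∀ b (hb : b < a), x ∉ s b ∧ x ≠ g b hb := by
    intro a g
    obtain ⟨x, hx⟩ := hs a _ subset_rfl fun b => g b.1 b.2
    simp only [Set.mem_union, Set.mem_iUnion, Set.mem_range, not_or, not_exists] at hx
    exact ⟨x, hx.1.1, fun b hb => ⟨hx.1.2 ⟨b, hb⟩, fun h => hx.2 ⟨b, hb⟩ h.symm⟩⟩
  choose next hnext using step
  refine ⟨(wellFounded_lt (α := I)).fix next, fun a => ?_⟩
  have := hnext a fun b _ => (wellFounded_lt (α := I)).fix next b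
  rwa [← WellFounded.fix_eq wellFounded_lt next a] at this

theorem mem_closure_iff_exists_finset {G I : Type*} [AddCommGroup G] (d : I → G) (S : Set I)
    {z : G} (hz : z ∈ AddSubgroup.closure (d '' S)) :
    ∃ t : Finset I, (t : Set I) ⊆ S ∧ z ∈ AddSubgroup.closure (d '' (t : Set I)) := by
  classical
  induction hz using AddSubgroup.closure_induction with
  | mem x hx =>
    obtain ⟨a, ha, rfl⟩ := hx
    exact ⟨{a}, by simpa using ha, AddSubgroup.subset_closure (by simp)⟩
  | zero => exact ⟨∅, by simp, AddSubgroup.zero_mem _⟩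
  | add x y _ _ hx hy =>
    obtain ⟨t, ht, hxt⟩ := hx
    obtain ⟨u, hu, hyu⟩ := hy
    refine ⟨t ∪ u, by simp [ht, hu], AddSubgroup.add_mem _ ?_ ?_⟩
    · exact AddSubgroup.closure_mono (Set.image_mono (by simp)) hxt
    · exact AddSubgroup.closure_mono (Set.image_mono (by simp)) hyu
  | neg x _ hx =>
    obtain ⟨t, ht, hxt⟩ := hx
    exact ⟨t, ht, AddSubgroup.neg_mem _ hxt⟩

/-- A nonzero element of a generated subgroup has a leading term. -/
theorem exists_leading_term {G I : Type*} [AddCommGroup G] [LinearOrder I] (d : I → G) (S : Set I)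
    {z : G} (hz : z ∈ AddSubgroup.closure (d '' S)) (hz0 : z ≠ 0) :
    ∃ a ∈ S, ∃ k : ℤ, k ≠ 0 ∧ ∃ h ∈ AddSubgroup.closure (d '' {b | b < a ∧ b ∈ S}),
      z = h + k • d a := by
  obtain ⟨t, htS, hzt⟩ := mem_closure_iff_exists_finset d S hz
  clear hz
  induction t using Finset.induction_on_max with
  | empty => simp [hz0] at hzt
  | insert a t hmax ih =>
    rw [Finset.coe_insert, Set.insert_subset_iff] at htS
    rw [Finset.coe_insert, Set.image_insert_eq, Set.insert_eq, AddSubgroup.closure_union,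
      AddSubgroup.mem_sup] at hzt
    obtain ⟨y, hy, h, hh, rfl⟩ := hzt
    obtain ⟨k, rfl⟩ := AddSubgroup.mem_closure_singleton.1 hy
    by_cases hk : k = 0
    · exact ih htS.2 (by simpa [hk] using hh)
    · have hsub : (t : Set I) ⊆ {b | b < a ∧ b ∈ S} := fun b hb => ⟨hmax b hb, htS.2 hb⟩
      exact ⟨a, htS.1, k, hk, h, AddSubgroup.closure_mono (Set.image_mono hsub) hh, add_comm _ _⟩

/-- Generators are `p a` plus a fresh unit vector, used only if `p a` is farther than `1` from the
group generated earlier. A difference with leading term `k • d a` has squared norm `‖h + k • p a‖ ^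
2 + k ^ 2`: for `k = ±1` the first summand exceeds `1`, otherwise `k ^ 2 ≥ 4`. -/
theorem exists_addSubgroup_of_fresh {Γ I : Type*} [LinearOrder I] [WellFoundedLT I]
    (p : I → EllTwo Γ) (hp : Function.Surjective p) (γ : I → Γ)
    (hγ : ∀ a, p a (γ a) = 0 ∧ ∀ b < a, p b (γ a) = 0 ∧ γ a ≠ γ b) :
    ∃ D : AddSubgroup (EllTwo Γ), IsStrictlySeparated (Real.sqrt 2) (D : Set (EllTwo Γ)) ∧
      IsRDense 1 (D : Set (EllTwo Γ)) := by
  classical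
  set e : I → EllTwo Γ := fun a => lp.single 2 (γ a) (1 : ℝ) with he
  set d : I → EllTwo Γ := fun a => p a + e a with hd
  obtain ⟨S, hS⟩ : ∃ S : Set I, ∀ a, a ∈ S ↔
      ∀ h ∈ AddSubgroup.closure (d '' {b | b < a ∧ b ∈ S}), 1 < ‖p a - h‖ := by
    let next : ∀ a : I, (∀ b, b < a → Prop) → Prop := fun a ih =>
      ∀ h ∈ AddSubgroup.closure (d '' {b | ∃ hb : b < a, ih b hb}), 1 < ‖p a - h‖
    refine ⟨{a | (wellFounded_lt (α := I)).fix next a}, fun a => ?_⟩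
    rw [Set.mem_ofPred_eq, WellFounded.fix_eq]
    simp only [next, exists_prop, Set.mem_ofPred_eq]
  have hzero : ∀ a, ∀ h ∈ AddSubgroup.closure (d '' {b | b < a ∧ b ∈ S}), h (γ a) = 0 := by
    intro a h hh
    induction hh using AddSubgroup.closure_induction with
    | mem x hx =>
      obtain ⟨b, ⟨hb, -⟩, rfl⟩ := hx
      obtain ⟨h1, h2⟩ := (hγ a).2 b hb
      rw [hd, lp.coeFn_add, Pi.add_apply, h1, zero_add]
      exact lp.single_apply_ne _ _ _ h2
    | zero => rfl
    | add x y _ _ hx hy => rw [lp.coeFn_add, Pi.add_apply, hx, hy, add_zero]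
    | neg x _ hx => rw [lp.coeFn_neg, Pi.neg_apply, hx, neg_zero]
  have he1 : ∀ a, ‖e a‖ = 1 := fun a => by
    rw [he, lp.norm_single (by norm_num), norm_one]
  refine ⟨AddSubgroup.closure (d '' S), ?_, ?_⟩
  · intro x hx y hy hxy
    obtain ⟨a, ha, k, hk, h, hh, hz⟩ := exists_leading_term d S
      (AddSubgroup.sub_mem _ hx hy) (sub_ne_zero.2 hxy)
    have hw : (h + k • p a) (γ a) = 0 := by
      rw [lp.coeFn_add, Pi.add_apply, hzero a h hh, ← Int.cast_smul_eq_zsmul ℝ, lp.coeFn_smul,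
        Pi.smul_apply, (hγ a).1, smul_zero, add_zero]
    have hort : ⟪h + k • p a, (k : ℝ) • e a⟫ = 0 := by
      rw [inner_smul_right, he, lp.inner_single_right, hw]
      simp
    have hnorm : ‖x - y‖ ^ 2 = ‖h + k • p a‖ ^ 2 + (k : ℝ) ^ 2 := by
      have : x - y = (h + k • p a) + (k : ℝ) • e a := by
        rw [hz, hd, smul_add, ← add_assoc, Int.cast_smul_eq_zsmul ℝ]
      rw [this, norm_add_sq_real, hort, norm_smul, he1, Real.norm_eq_abs, mul_one, sq_abs]
      ring
    refine Real.sqrt_lt_sqrt (by norm_num) (?_ : 2 < ‖x - y‖ ^ 2) |>.trans_eq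
      (Real.sqrt_sq (norm_nonneg _))
    have hS' := (hS a).1 ha
    rcases eq_or_ne k 1 with rfl | hk1
    · have := hS' (-h) (AddSubgroup.neg_mem _ hh)
      rw [sub_neg_eq_add, add_comm] at this
      rw [hnorm, one_smul, Int.cast_one]
      nlinarith
    rcases eq_or_ne k (-1) with rfl | hk2
    · have := hS' h hh
      rw [← norm_neg, neg_sub, sub_eq_add_neg] at this
      rw [hnorm, neg_smul, one_smul, Int.cast_neg, Int.cast_one]
      nlinarith
    · have h4 : 4 ≤ k ^ 2 := by
        have : 2 ≤ |k| := by grind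
        nlinarith [sq_abs k]
      have h4 : (4 : ℝ) ≤ (k : ℝ) ^ 2 := by exact_mod_cast h4
      rw [hnorm]
      nlinarith [sq_nonneg ‖h + k • p a‖]
  · intro x
    obtain ⟨a, rfl⟩ := hp x
    by_cases ha : a ∈ S
    · refine ⟨d a, AddSubgroup.subset_closure ⟨a, ha, rfl⟩, ?_⟩
      rw [hd, sub_add_cancel_left, norm_neg, he1]
    · rw [hS] at ha
      push Not at ha
      obtain ⟨h, hh, hle⟩ := ha
      exact ⟨h, AddSubgroup.closure_mono (Set.image_mono fun b hb => hb.2) hh, hle⟩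

/-! ### Cardinality of `ℓ₂(Γ)` and the choice of fresh coordinates. -/

theorem countable_support_ellTwo {Γ : Type*} (x : EllTwo Γ) : (Function.support x).Countable := by
  have h := (lp.summable_inner (𝕜 := ℝ) x x).countable_support
  refine h.mono fun i hi => ?_
  simpa using hi

open Cardinal in
theorem aleph0_lt_of_power_eq {Γ : Type*} [Infinite Γ] (hΓ : #Γ ^ ℵ₀ = #Γ) : ℵ₀ < #Γ := by
  refine (cantor ℵ₀).trans_le ?_
  rw [← hΓ]
  exact power_le_power_right ((natCast_lt_aleph0 (n := 2)).le.trans (aleph0_le_mk Γ))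

open Cardinal in
-- A vector is determined by a sequence covering its countable support and its values along it.
theorem mk_ellTwo_le {Γ : Type*} [Infinite Γ] (hΓ : #Γ ^ ℵ₀ = #Γ) : #(EllTwo Γ) ≤ #Γ := by
  have hex : ∀ x : EllTwo Γ, ∃ s : ℕ → Γ, Function.support x ⊆ Set.range s := fun x =>
    Set.countable_iff_exists_subset_range.1 (countable_support_ellTwo x)
  choose s hs using hex
  have hinj : Function.Injective fun x : EllTwo Γ => (s x, fun n => x (s x n)) := by
    intro x y hxy
    simp only [Prod.mk.injEq] at hxy
    obtain ⟨h1, h2⟩ := hxy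
    ext i
    by_cases hi : i ∈ Set.range (s x)
    · obtain ⟨n, rfl⟩ := hi
      have := congrFun h2 n
      exact this.trans (by rw [h1])
    · have hx : x i = 0 := by
        by_contra h
        exact hi (hs x h)
      have hy : y i = 0 := by
        by_contra h
        exact hi (h1 ▸ hs y h)
      rw [hx, hy]
  refine (mk_le_of_injective hinj).trans ?_
  have hc : Cardinal.lift.{_, 0} #(ℕ → ℝ) ≤ #Γ := by
    rw [← power_def, mk_real, mk_nat, continuum_power_aleph0, lift_continuum, ← two_power_aleph0,
      ← hΓ]
    exact power_le_power_right ((natCast_lt_aleph0 (n := 2)).le.trans (aleph0_le_mk Γ))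
  rw [mk_prod]
  refine mul_le_of_le (aleph0_le_mk Γ) ?_ hc
  simp [hΓ]

open Cardinal in
theorem exists_addSubgroup_ellTwo {Γ : Type*} [Infinite Γ] (hΓ : #Γ ^ ℵ₀ = #Γ) :
    ∃ D : AddSubgroup (EllTwo Γ), IsStrictlySeparated (Real.sqrt 2) (D : Set (EllTwo Γ)) ∧
      IsRDense 1 (D : Set (EllTwo Γ)) := by
  obtain ⟨I, hI⟩ : ∃ I, I = EllTwo Γ := ⟨_, rfl⟩
  obtain ⟨p, hp⟩ : ∃ p : I → EllTwo Γ, Function.Surjective p := by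
    subst hI; exact ⟨id, Function.surjective_id⟩
  have hcard : #I ≤ #Γ := by rw [hI]; exact mk_ellTwo_le hΓ
  have hω := aleph0_lt_of_power_eq hΓ
  clear hI
  -- In a well-order of minimal type, proper initial segments have fewer than `#Γ` elements, so
  -- their countable supports cannot exhaust `Γ`.
  obtain ⟨_, _, hord⟩ := exists_ord_eq_type_lt I
  obtain ⟨γ, hγ⟩ := exists_fresh (fun a => Function.support (p a)) fun a u hu g => by
    have hIio : #(Set.Iio a) < #Γ := (mk_Iio_lt a hord).trans_le hcard
    by_contra! hall
    have huniv : u ∪ Set.range g = Set.univ := Set.eq_univ_of_forall hall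
    refine lt_irrefl #Γ ?_
    calc #Γ = #(u ∪ Set.range g : Set Γ) := by rw [huniv, mk_univ]
      _ ≤ #u + #(Set.range g) := mk_union_le _ _
      _ < #Γ := add_lt_of_lt hω.le ?_ (mk_range_le.trans_lt hIio)
    refine (mk_le_mk_of_subset hu).trans_lt ((mk_union_le _ _).trans_lt
      (add_lt_of_lt hω.le ?_ ?_))
    · exact ((countable_support_ellTwo (p a)).le_aleph0).trans_lt hω
    · refine (mk_iUnion_le_sum_mk.trans (sum_le_sum _ (fun _ : Set.Iio a => ℵ₀) fun b =>
        (countable_support_ellTwo (p b.1)).le_aleph0)).trans_lt ?_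
      rw [sum_const']
      exact mul_lt_of_lt hω.le hIio hω
  exact exists_addSubgroup_of_fresh p hp γ (by simpa using hγ)

theorem not_finiteDimensional_ellTwo {Γ : Type*} [Infinite Γ] :
    ¬ FiniteDimensional ℝ (EllTwo Γ) := by
  classical
  intro hfin
  have hon : Orthonormal ℝ fun i : Γ => (lp.single 2 i (1 : ℝ) : EllTwo Γ) := by
    rw [orthonormal_iff_ite]
    intro i j
    rw [lp.inner_single_left, lp.single_apply, Pi.single_apply]
    split_ifs <;> simp
  have := hon.linearIndependent.finite
  exact not_finite Γ

end TilingNorm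
end

theorem theorem3p7 {Γ : Type*} [Infinite Γ]
    (hΓ : Cardinal.mk Γ ^ Cardinal.aleph0 = Cardinal.mk Γ) :
    -- subgroups as in the construction of the norm exist
    (∃ D : AddSubgroup (EllTwo Γ),
      TilingNorm.IsStrictlySeparated (Real.sqrt 2) (D : Set (EllTwo Γ)) ∧
      TilingNorm.IsRDense 1 (D : Set (EllTwo Γ))) ∧
    ∀ D : AddSubgroup (EllTwo Γ),
      TilingNorm.IsStrictlySeparated (Real.sqrt 2) (D : Set (EllTwo Γ)) →
      TilingNorm.IsRDense 1 (D : Set (EllTwo Γ)) →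
      ∀ (N : EllTwo Γ → ℝ), N = TilingNorm.tilingNorm (D : Set (EllTwo Γ)) →
      ∀ (T : Set (Set (EllTwo Γ))), T = TilingNorm.voronoiFamily (D : Set (EllTwo Γ)) →
      -- `N` is an equivalent norm, and the cells are a tiling by the unit balls of `N` around `D`
      (TilingNorm.IsEquivalentNorm N ∧
        (∀ d ∈ D, TilingNorm.voronoiCell (D : Set (EllTwo Γ)) d = {x | N (x - d) ≤ 1}) ∧
        TilingNorm.IsTiling T) ∧
      -- no LUR points
      (¬ ∃ x, TilingNorm.IsLURPoint N x) ∧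
      -- no Fréchet differentiability at strongly exposed points
      (∀ x₀ ∈ TilingNorm.unitSphere N,
        TilingNorm.IsStronglyExposedPoint (TilingNorm.unitBall N) x₀ →
          ¬ DifferentiableAt ℝ N x₀) ∧
      -- regular points of the sphere
      (∀ x₀ ∈ TilingNorm.unitSphere N, TilingNorm.IsRegularPoint T x₀ ↔ ‖x₀‖ < 1) ∧
      -- density of the `Δ`-QP-points in the sphere
      ({x | TilingNorm.IsDeltaQPPoint (TilingNorm.unitBall N) x} ⊆ TilingNorm.unitSphere N ∧
        TilingNorm.unitSphere N ⊆
          closure {x | TilingNorm.IsDeltaQPPoint (TilingNorm.unitBall N) x}) ∧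
      -- neither rotund nor Gâteaux differentiable
      (¬ TilingNorm.IsRotund N) ∧
      (¬ TilingNorm.IsGateauxDifferentiableNorm N) := by
  refine ⟨TilingNorm.exists_addSubgroup_ellTwo hΓ, ?_⟩
  rintro D hs hd _ rfl _ rfl
  have hE := TilingNorm.not_finiteDimensional_ellTwo (Γ := Γ)
  refine ⟨⟨TilingNorm.isEquivalentNorm_tilingNorm hs hd,
    fun d hdD => TilingNorm.voronoiCell_eq hs hdD, TilingNorm.isTiling_voronoiFamily hs hd⟩,
    fun ⟨x, hx⟩ => TilingNorm.not_isLURPoint hE hs hd x hx,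
    fun x hx hexp => hexp.not_differentiableAt hE hs hd hx, fun x hx => ⟨fun hreg => ?_,
    TilingNorm.isRegularPoint_of_norm_lt_one hs⟩,
    ⟨fun x hx => TilingNorm.frontier_unitBall hs hx.1,
    (TilingNorm.unitSphere_subset_closure hE hs hd).trans (closure_mono fun x hx => ?_)⟩,
    TilingNorm.not_isRotund hE hs hd, TilingNorm.not_isGateauxDifferentiableNorm hE hs hd⟩
  · by_contra h
    exact hreg (TilingNorm.isSingularPoint_of_one_le_norm hE hs hd
      ((TilingNorm.tilingNorm_le_one_iff hs).1 (le_of_eq hx)) (not_lt.1 h))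
  · obtain ⟨F, hF⟩ := TilingNorm.exists_isPolyhedralAt_of_norm_lt_one hs hd hx.1 hx.2
    exact hF.isDeltaQPPoint hs hd
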